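/- Let $k\ge 2$ and let $\beta_0<\beta_1<\dots<\beta_{k-1}<\beta_0+1=:\beta_k$ be real numbers, so that the half-open intervals $I_i=[\beta_i,\beta_{i+1}[$, $0\le i\le k-1$, taken modulo $1$, form a partition of the circle $\mathbb{R}/\mathbb{Z}$ into $k$ intervals of lengths $\lambda_i=\beta_{i+1}-\beta_i$. Assume that $\lambda_0,\dots,\lambda_{k-1}$ are linearly independent over $\mathbb{Q}$, and let $\alpha=\lambda_i$ or $\alpha=-\lambda_i$ for some $i$ (so $\alpha$ is irrational). For $x\in\mathbb{R}/\mathbb{Z}$ let $U=(U_n)_{n\ge 0}$ be the infinite word over $\{0,\dots,k-1\}$ that codes the positive orbit of $x$ under the rotation by $\alpha$, that is, $U_n=j$ if and only if $x+n\alpha\in I_j$ modulo $1$. Then $U$ is recurrent (every factor of $U$ occurs infinitely many times in $U$) and has property $R_k$: for every factor $w$ of $U$ there are exactly $k$ distinct return words over $w$, where a return word over $w$ is a word $U_mU_{m+1}\cdots U_{m'-1}$ such that $m<m'$ are two consecutive positions of occurrence of $w$ in $U$. -/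

import Mathlib

/-! ### Infinite words, factors and return words -/

/-- The finite word `U_i U_{i+1} ⋯ U_{i+n-1}` of the infinite word `U`. -/
def wordSegment {A : Type*} (U : ℕ → A) (i n : ℕ) : List A :=
  List.ofFn (fun j : Fin n => U (i + j))

/-- The finite word `w` occurs in `U` at position `i`. -/
def OccursAt {A : Type*} (U : ℕ → A) (w : List A) (i : ℕ) : Prop :=
  wordSegment U i w.length = w

/-- The language `L(U)`: the set of factors of `U` (of all lengths). -/
def factorSet {A : Type*} (U : ℕ → A) : Set (List A) :=
  {w | ∃ i, OccursAt U w i}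

/-- `U` is recurrent: every factor of `U` occurs infinitely many times in `U`. -/
def IsRecurrentWord {A : Type*} (U : ℕ → A) : Prop :=
  ∀ w ∈ factorSet U, {i | OccursAt U w i}.Infinite

/-- The set of return words over `w` in `U`: all words `U_i U_{i+1} ⋯ U_{j-1}` where `i < j` are
two consecutive positions of occurrence of `w` in `U`. -/
def returnWords {A : Type*} (U : ℕ → A) (w : List A) : Set (List A) :=
  {v | ∃ i j, i < j ∧ OccursAt U w i ∧ OccursAt U w j ∧
    (∀ m, i < m → m < j → ¬ OccursAt U w m) ∧ v = wordSegment U i (j - i)}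

/-- Property `R_n`: every factor of `U` has exactly `n` return words. -/
def HasPropertyR {A : Type*} (n : ℕ) (U : ℕ → A) : Prop :=
  ∀ w ∈ factorSet U, (returnWords U w).encard = n

/-! ### Partitions of the circle and codings of rotations -/

/-- A partition of the circle `ℝ/ℤ` by `p ≥ 2` consecutive points, given by real lifts
`β_0 < β_1 < ⋯ < β_{p-1} < β_0 + 1`. -/
structure CirclePartition (p : ℕ) where
  two_le : 2 ≤ p
  pt : Fin p → ℝ
  strictMono : StrictMono pt
  lt_add_one : ∀ i j, pt i < pt j + 1

namespace CirclePartition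

variable {p : ℕ}

/-- The index of the first point `β_0`. -/
def first (P : CirclePartition p) : Fin p := ⟨0, lt_of_lt_of_le Nat.zero_lt_two P.two_le⟩

/-- The right end of the `i`-th interval: `β_{i+1}`, or (a lift of) `β_p = β_0` if `i = p - 1`. -/
noncomputable def rightEnd (P : CirclePartition p) (i : Fin p) : ℝ :=
  if h : (i : ℕ) + 1 < p then P.pt ⟨i + 1, h⟩ else P.pt P.first + 1

/-- The length of the `i`-th interval. -/
noncomputable def length (P : CirclePartition p) (i : Fin p) : ℝ := P.rightEnd i - P.pt i

/-- The `i`-th interval `[β_i, β_{i+1}[` of the circle. -/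
def arc (P : CirclePartition p) (i : Fin p) : Set UnitAddCircle :=
  (fun t : ℝ => (t : UnitAddCircle)) '' Set.Ico (P.pt i) (P.rightEnd i)

theorem rightEnd_le_pt (P : CirclePartition p) {i j : Fin p} (h : i < j) :
    P.rightEnd i ≤ P.pt j := by
  have hij : (i : ℕ) < j := h
  have h1 : (i : ℕ) + 1 < p := lt_of_le_of_lt hij j.2
  rw [rightEnd, dif_pos h1]
  exact P.strictMono.monotone (Fin.le_def.2 hij)

theorem pt_first_le (P : CirclePartition p) (i : Fin p) : P.pt P.first ≤ P.pt i :=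
  P.strictMono.monotone (Fin.le_def.2 (Nat.zero_le _))

theorem rightEnd_le (P : CirclePartition p) (i : Fin p) :
    P.rightEnd i ≤ P.pt P.first + 1 := by
  unfold rightEnd
  split_ifs with h
  · exact (P.lt_add_one _ _).le
  · exact le_rfl

theorem eq_of_mem_Ico (P : CirclePartition p) {i j : Fin p} {t : ℝ}
    (hi : t ∈ Set.Ico (P.pt i) (P.rightEnd i)) (hj : t ∈ Set.Ico (P.pt j) (P.rightEnd j)) :
    i = j := by
  rcases lt_trichotomy i j with h | h | h
  · exact absurd (lt_of_lt_of_le hi.2 (P.rightEnd_le_pt h)) (not_lt.2 hj.1)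
  · exact h
  · exact absurd (lt_of_lt_of_le hj.2 (P.rightEnd_le_pt h)) (not_lt.2 hi.1)

/-- The intervals form a partition of the circle. -/
theorem existsUnique_arc (P : CirclePartition p) (y : UnitAddCircle) :
    ∃! i, y ∈ P.arc i := by
  classical
  have : Fact ((0 : ℝ) < 1) := ⟨one_pos⟩
  refine existsUnique_of_exists_of_unique ?_ ?_
  · obtain ⟨t, ht, rfl⟩ : ∃ t ∈ Set.Ico (P.pt P.first) (P.pt P.first + 1),
        (t : UnitAddCircle) = y :=
      ⟨(AddCircle.equivIco 1 (P.pt P.first) y : ℝ), (AddCircle.equivIco 1 (P.pt P.first) y).2,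
        (AddCircle.equivIco 1 (P.pt P.first)).symm_apply_apply y⟩
    have hne : (Finset.univ.filter (fun i => P.pt i ≤ t)).Nonempty :=
      ⟨P.first, by simpa using ht.1⟩
    set i := (Finset.univ.filter (fun i => P.pt i ≤ t)).max' hne with hi
    have hmem : P.pt i ≤ t := by
      have := Finset.max'_mem _ hne
      simpa using (Finset.mem_filter.1 this).2
    refine ⟨i, t, ⟨hmem, ?_⟩, rfl⟩
    unfold rightEnd
    split_ifs with h
    · by_contra hcon
      have hle : (⟨i + 1, h⟩ : Fin p) ≤ i :=
        Finset.le_max' (Finset.univ.filter (fun i => P.pt i ≤ t)) _ (Finset.mem_filter.2 ⟨Finset.mem_univ _, not_lt.1 hcon⟩)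
      have : (i : ℕ) + 1 ≤ i := hle
      omega
    · exact ht.2
  · rintro i j ⟨s, hs, hsy⟩ ⟨t, ht, hty⟩
    have hs' : s ∈ Set.Ico (P.pt P.first) (P.pt P.first + 1) :=
      ⟨(P.pt_first_le i).trans hs.1, lt_of_lt_of_le hs.2 (P.rightEnd_le i)⟩
    have ht' : t ∈ Set.Ico (P.pt P.first) (P.pt P.first + 1) :=
      ⟨(P.pt_first_le j).trans ht.1, lt_of_lt_of_le ht.2 (P.rightEnd_le j)⟩
    have hst : s = t :=
      (AddCircle.coe_eq_coe_iff_of_mem_Ico hs' ht').1 (hsy.trans hty.symm)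
    subst hst
    exact P.eq_of_mem_Ico hs ht

/-- The index of the interval that contains the point `y` of the circle. -/
noncomputable def letter (P : CirclePartition p) (y : UnitAddCircle) : Fin p :=
  (P.existsUnique_arc y).choose

/-- The coding of the positive orbit of `x` under the rotation by angle `α`, with respect to the
partition `P`. -/
noncomputable def coding (P : CirclePartition p) (α : ℝ) (x : UnitAddCircle) : ℕ → Fin p :=
  fun n => P.letter (x + n • (α : UnitAddCircle))

theorem letter_eq_iff (P : CirclePartition p) (y : UnitAddCircle) (i : Fin p) :
    P.letter y = i ↔ y ∈ P.arc i := by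
  constructor
  · rintro rfl
    exact (P.existsUnique_arc y).choose_spec.1
  · intro h
    exact ((P.existsUnique_arc y).choose_spec.2 i h).symm

/-- The defining property of the coding: `u_n = i` if and only if `x + nα ∈ [β_i, β_{i+1}[`. -/
theorem coding_eq_iff (P : CirclePartition p) (α : ℝ) (x : UnitAddCircle) (n : ℕ) (i : Fin p) :
    P.coding α x n = i ↔ x + n • (α : UnitAddCircle) ∈ P.arc i :=
  P.letter_eq_iff _ i

end CirclePartition

/-! Call the points with the same coding of length `n` a cylinder. The angle is the length of an
arc, up to sign, so the rotation maps some division point `s` to another one `t`. This forces every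
cylinder with `n > 0` to contain exactly one breakpoint (`exists_breakpoint_sameCoding`,
`eq_of_sameCoding_of_mem_breakpoints`). The orbit of `x` visits every cylinder, so the return words
`v` over `w` correspond to the cylinders of the words `vw`, hence to their breakpoints, the
`returnPoints`.

To count these, rational independence of the lengths makes the backward orbits of the `k - 1`
division points other than `s` infinite and disjoint (`eq_of_point_sub_nsmul_eq`), and these orbits
contain all breakpoints. Let `a` be the breakpoint of the cylinder of `w`. Each of these orbits
contributes one return point, its first visit to the cylinder at a point other than `a`; with `a`
itself the total is `k` (`encard_returnPoints_of_pos`). Recurrence follows from density of the orbit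
and right-continuity of the coding. -/

/-! ### Oriented arcs of the circle and density of orbits -/

/-- The length of the positively oriented arc of the circle that goes from `x` to `y`. -/
noncomputable def circleGap (x y : UnitAddCircle) : ℝ :=
  (AddCircle.equivIco 1 0 (y - x) : ℝ)

theorem circleGap_nonneg (x y : UnitAddCircle) : 0 ≤ circleGap x y :=
  (AddCircle.equivIco 1 0 (y - x)).2.1

theorem circleGap_lt_one (x y : UnitAddCircle) : circleGap x y < 1 :=
  (AddCircle.equivIco 1 0 (y - x)).2.2.trans_eq (zero_add 1)

theorem coe_circleGap (x y : UnitAddCircle) : (circleGap x y : UnitAddCircle) = y - x :=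
  (AddCircle.equivIco 1 0).symm_apply_apply (y - x)

theorem circleGap_eq_of_coe {x y : UnitAddCircle} {t : ℝ} (h0 : 0 ≤ t) (h1 : t < 1)
    (h : (t : UnitAddCircle) = y - x) : circleGap x y = t := by
  refine (AddCircle.coe_eq_coe_iff_of_mem_Ico (p := (1 : ℝ)) (a := 0)
    ⟨circleGap_nonneg x y, ?_⟩ ⟨h0, ?_⟩).1 ((coe_circleGap x y).trans h.symm)
  · simpa using circleGap_lt_one x y
  · simpa using h1

theorem circleGap_add_right (x y z : UnitAddCircle) :
    circleGap (x + z) (y + z) = circleGap x y := by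
  simp [circleGap]

theorem circleGap_self (x : UnitAddCircle) : circleGap x x = 0 :=
  circleGap_eq_of_coe le_rfl one_pos (by simp)

theorem eq_of_circleGap_eq_left {x x' y : UnitAddCircle} (h : circleGap x y = circleGap x' y) :
    x = x' := by
  have := congrArg (fun t : ℝ => (t : UnitAddCircle)) h
  simpa [coe_circleGap] using this

theorem eq_of_circleGap_eq_zero {x y : UnitAddCircle} (h : circleGap x y = 0) : x = y :=
  eq_of_circleGap_eq_left (h.trans (circleGap_self y).symm)

theorem circleGap_add_circleGap {b c y : UnitAddCircle} (h : circleGap c y ≤ circleGap b y) :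
    circleGap b c + circleGap c y = circleGap b y := by
  have : circleGap b c = circleGap b y - circleGap c y := by
    apply circleGap_eq_of_coe
    · linarith
    · linarith [circleGap_lt_one b y, circleGap_nonneg c y]
    · rw [AddCircle.coe_sub, coe_circleGap, coe_circleGap]; abel
  linarith

/-- The positive orbit of an irrational rotation enters every small arc to the right of a point,
arbitrarily late. -/
theorem exists_nsmul_mem_right_arc {θ : UnitAddCircle} (hθ : ∀ n : ℕ, n • θ = 0 → n = 0)
    (x y : UnitAddCircle) {ε : ℝ} (hε : 0 < ε) (N : ℕ) :
    ∃ n, N ≤ n ∧ 0 < circleGap y (x + n • θ) ∧ circleGap y (x + n • θ) < ε := by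
  have : Fact ((0 : ℝ) < 1) := ⟨one_pos⟩
  have hd : DenseRange (fun n : ℕ => n • θ) := by
    rw [← denseRange_zsmul_iff_nsmul, AddCircle.denseRange_zsmul_iff, addOrderOf_eq_zero_iff']
    intro n hn h
    exact hn.ne' (hθ n h)
  -- The cap at `1` makes a lift in the open interval from `0` to `δ` equal to the gap itself.
  set δ := min ε 1
  have hδ : 0 < δ := lt_min hε one_pos
  let V : Set UnitAddCircle := (fun t : ℝ => (t : UnitAddCircle)) '' Set.Ioo 0 δ
  have hV : IsOpen V := QuotientAddGroup.isOpenMap_coe _ isOpen_Ioo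
  have hW : IsOpen ((fun z => x + N • θ + z - y) ⁻¹' V) := hV.preimage (by fun_prop)
  obtain ⟨n, t, ht, htn⟩ := hd.exists_mem_open hW
    ⟨y - (x + N • θ) + ((δ / 2 : ℝ) : UnitAddCircle), δ / 2, ⟨by linarith, by linarith⟩, by
      simp only; abel⟩
  have hg : circleGap y (x + (N + n) • θ) = t := by
    refine circleGap_eq_of_coe ht.1.le (ht.2.trans_le (min_le_right _ _)) ?_
    simp only at htn
    rw [htn, add_nsmul]; abel
  refine ⟨N + n, Nat.le_add_right _ _, ?_, ?_⟩
  · rw [hg]; exact ht.1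
  · rw [hg]; exact ht.2.trans_le (min_le_left _ _)

/-! ### Letters and nearest division points -/

namespace CirclePartition

variable {p : ℕ}

/-- The `i`-th division point of the circle. -/
noncomputable def point (P : CirclePartition p) (i : Fin p) : UnitAddCircle := (P.pt i : ℝ)

theorem point_injective (P : CirclePartition p) : Function.Injective P.point := by
  have : Fact ((0 : ℝ) < 1) := ⟨one_pos⟩
  intro i j h
  exact P.strictMono.injective ((AddCircle.coe_eq_coe_iff_of_mem_Ico
    ⟨P.pt_first_le i, P.lt_add_one i _⟩ ⟨P.pt_first_le j, P.lt_add_one j _⟩).1 h)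

theorem exists_lift (P : CirclePartition p) (y : UnitAddCircle) :
    ∃ t ∈ Set.Ico (P.pt (P.letter y)) (P.rightEnd (P.letter y)), (t : UnitAddCircle) = y :=
  (P.letter_eq_iff y _).1 rfl

/-- The letter of `y` is the index of the nearest division point on the left of `y`. -/
theorem circleGap_letter_le (P : CirclePartition p) (y : UnitAddCircle) (l : Fin p) :
    circleGap (P.point (P.letter y)) y ≤ circleGap (P.point l) y := by
  obtain ⟨t, ⟨h1, h2⟩, hy⟩ := P.exists_lift y
  set j := P.letter y
  have hj := P.pt_first_le j
  have hr := P.rightEnd_le j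
  have hl := P.pt_first_le l
  have hl1 := P.lt_add_one l P.first
  have e1 : circleGap (P.point j) y = t - P.pt j := by
    refine circleGap_eq_of_coe (by linarith) (by linarith) ?_
    rw [AddCircle.coe_sub, hy]; rfl
  rcases le_or_gt l j with h | h
  · have hlj := P.strictMono.monotone h
    have e2 : circleGap (P.point l) y = t - P.pt l := by
      refine circleGap_eq_of_coe (by linarith) (by linarith) ?_
      rw [AddCircle.coe_sub, hy]; rfl
    linarith
  · have hlj := P.rightEnd_le_pt h
    have e2 : circleGap (P.point l) y = t - P.pt l + 1 := by
      refine circleGap_eq_of_coe (by linarith) (by linarith) ?_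
      rw [AddCircle.coe_add_period, AddCircle.coe_sub, hy]; rfl
    linarith

theorem letter_eq_of_circleGap_le (P : CirclePartition p) {y : UnitAddCircle} {j : Fin p}
    (h : ∀ l, circleGap (P.point j) y ≤ circleGap (P.point l) y) : P.letter y = j :=
  P.point_injective (eq_of_circleGap_eq_left
    (le_antisymm (P.circleGap_letter_le y j) (h (P.letter y))))

theorem letter_point (P : CirclePartition p) (j : Fin p) : P.letter (P.point j) = j :=
  P.letter_eq_of_circleGap_le fun l => by
    rw [circleGap_self]; exact circleGap_nonneg _ _

/-- The arcs are closed on the left and open on the right, so the letter is locally constant to the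
right. -/
theorem exists_right_arc_letter_eq (P : CirclePartition p) (y : UnitAddCircle) :
    ∃ ε > 0, ∀ z, circleGap y z < ε → P.letter z = P.letter y := by
  obtain ⟨t, ⟨h1, h2⟩, hy⟩ := P.exists_lift y
  refine ⟨P.rightEnd (P.letter y) - t, by linarith, fun z hz => ?_⟩
  rw [letter_eq_iff]
  refine ⟨t + circleGap y z, ⟨?_, by linarith⟩, ?_⟩
  · linarith [circleGap_nonneg y z]
  · simp [coe_circleGap, hy]

/-! ### Codings of length `n` and their breakpoints -/

/-- The points `y` and `z` have the same coding of length `n` under the rotation by `θ`. -/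
def SameCoding (P : CirclePartition p) (θ : UnitAddCircle) (n : ℕ) (y z : UnitAddCircle) : Prop :=
  ∀ m < n, P.letter (y + m • θ) = P.letter (z + m • θ)

/-- The points at which the coding of length `n` under the rotation by `θ` may change. -/
def breakpoints (P : CirclePartition p) (θ : UnitAddCircle) (n : ℕ) : Set UnitAddCircle :=
  {c | ∃ j, ∃ m < n, c + m • θ = P.point j}

variable {P : CirclePartition p} {θ : UnitAddCircle} {n r : ℕ} {x y z c : UnitAddCircle}

theorem SameCoding.symm (h : P.SameCoding θ n y z) : P.SameCoding θ n z y :=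
  fun m hm => (h m hm).symm

theorem SameCoding.trans (h : P.SameCoding θ n x y) (h' : P.SameCoding θ n y z) :
    P.SameCoding θ n x z :=
  fun m hm => (h m hm).trans (h' m hm)

theorem SameCoding.mono {m : ℕ} (h : P.SameCoding θ n y z) (hm : m ≤ n) :
    P.SameCoding θ m y z :=
  fun i hi => h i (hi.trans_le hm)

theorem sameCoding_add_iff : P.SameCoding θ (r + n) y z ↔
    P.SameCoding θ r y z ∧ P.SameCoding θ n (y + r • θ) (z + r • θ) := by
  constructor
  · refine fun h => ⟨h.mono (Nat.le_add_right _ _), fun m hm => ?_⟩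
    have := h (r + m) (by omega)
    simpa only [add_nsmul, add_assoc] using this
  · rintro ⟨h, h'⟩ m hm
    rcases lt_or_ge m r with hr | hr
    · exact h m hr
    · obtain ⟨q, rfl⟩ := Nat.exists_eq_add_of_le hr
      have := h' q (by omega)
      simpa only [add_nsmul, add_assoc] using this

theorem breakpoints_mono {m : ℕ} (h : m ≤ n) : P.breakpoints θ m ⊆ P.breakpoints θ n := by
  rintro c ⟨j, i, hi, hc⟩
  exact ⟨j, i, hi.trans_le h, hc⟩

theorem finite_breakpoints (P : CirclePartition p) (θ : UnitAddCircle) (n : ℕ) :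
    (P.breakpoints θ n).Finite := by
  refine (Set.finite_range (fun q : Fin p × Fin n => P.point q.1 - (q.2 : ℕ) • θ)).subset ?_
  rintro c ⟨j, m, hm, hc⟩
  exact ⟨(j, ⟨m, hm⟩), by simp [← hc]⟩

/-- The nearest breakpoint on the left of `y` has the same coding as `y`. -/
theorem sameCoding_of_circleGap_le
    (h : ∀ d ∈ P.breakpoints θ n, circleGap c y ≤ circleGap d y) : P.SameCoding θ n c y := by
  intro m hm
  symm
  apply P.letter_eq_of_circleGap_le
  -- No breakpoint lies strictly between `c` and `y`, so moving from `c + m • θ` to `y + m • θ`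
  -- lengthens the gaps from all division points by the same amount, and the nearest one stays the
  -- same.
  have key : ∀ l, circleGap (P.point l) (c + m • θ) + circleGap c y =
      circleGap (P.point l) (y + m • θ) := by
    intro l
    have h1 := h (P.point l - m • θ) ⟨l, m, hm, by abel⟩
    have h2 := circleGap_add_circleGap (b := P.point l) (c := c + m • θ) (y := y + m • θ) (by
      rw [circleGap_add_right]
      refine h1.trans_eq ?_
      rw [← circleGap_add_right _ _ (m • θ)]
      congr 1; abel)
    rwa [circleGap_add_right] at h2
  intro l
  rw [← key, ← key]
  linarith [P.circleGap_letter_le (c + m • θ) l]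

theorem exists_nearest_breakpoint (P : CirclePartition p) (θ y : UnitAddCircle) (hn : 0 < n) :
    ∃ c ∈ P.breakpoints θ n, ∀ d ∈ P.breakpoints θ n, circleGap c y ≤ circleGap d y :=
  Set.exists_min_image _ _ (P.finite_breakpoints θ n)
    ⟨P.point P.first, P.first, 0, hn, by simp⟩

theorem exists_breakpoint_sameCoding (P : CirclePartition p) (θ y : UnitAddCircle) (hn : 0 < n) :
    ∃ c ∈ P.breakpoints θ n, P.SameCoding θ n c y := by
  obtain ⟨c, hc, h⟩ := P.exists_nearest_breakpoint θ y hn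
  exact ⟨c, hc, sameCoding_of_circleGap_le h⟩

/-- If the rotation maps one division point to another, distinct breakpoints have distinct
codings. -/
theorem eq_of_sameCoding_of_mem_breakpoints {s t : Fin p} (hst : P.point s + θ = P.point t)
    {c d : UnitAddCircle} (hc : c ∈ P.breakpoints θ n) (hd : d ∈ P.breakpoints θ n)
    (h : P.SameCoding θ n c d) : c = d := by
  induction n generalizing c d with
  | zero => obtain ⟨j, m, hm, -⟩ := hc; omega
  | succ n ih =>
    rw [add_comm n 1, sameCoding_add_iff] at h
    obtain ⟨h0, h1⟩ := h
    replace h0 : P.letter c = P.letter d := by simpa using h0 0 one_pos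
    simp only [one_nsmul] at h1
    have hshift : ∀ c ∈ P.breakpoints θ (n + 1),
        (∃ j, c = P.point j) ∨ c + θ ∈ P.breakpoints θ n := by
      rintro c ⟨j, m, hm, hc⟩
      rcases m with _ | m
      · exact Or.inl ⟨j, by simpa using hc⟩
      · refine Or.inr ⟨j, m, by omega, ?_⟩
        rw [← hc, succ_nsmul]; abel
    -- The remaining case compares a division point with a breakpoint `q` whose image is a
    -- breakpoint for length `n`. Only here is the relation between `s` and `t` needed.
    have mixed : ∀ j q, P.letter q = j → q + θ ∈ P.breakpoints θ n →
        P.SameCoding θ n (P.point j + θ) (q + θ) → P.point j = q := by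
      intro j q hq hqn hs
      have hn : 0 < n := by obtain ⟨-, m, hm, -⟩ := hqn; omega
      have htn : P.point t ∈ P.breakpoints θ n := ⟨t, 0, hn, by simp⟩
      by_cases hj : j = s
      · subst hj
        rw [hst] at hs
        exact add_right_cancel (hst.trans (ih htn hqn hs))
      -- By induction `q + θ` is the breakpoint nearest to `P.point j + θ` on the left, so it is no
      -- farther than `P.point t`. Rotating back, `q` lies between `s` and `j`; but `j` lies between
      -- `s` and `q`, since it is the letter of `q`. The two gaps between `j` and `q` then sum to
      -- zero.
      obtain ⟨a, ha, hmin⟩ := P.exists_nearest_breakpoint θ (P.point j + θ) hn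
      obtain rfl : a = q + θ := ih ha hqn ((sameCoding_of_circleGap_le hmin).trans hs)
      have h1 := hmin _ htn
      rw [← hst, circleGap_add_right, circleGap_add_right] at h1
      have h2 := P.circleGap_letter_le q s
      rw [hq] at h2
      have h3 := circleGap_add_circleGap h1
      have h4 := circleGap_add_circleGap h2
      exact eq_of_circleGap_eq_zero
        (by linarith [circleGap_nonneg (P.point j) q, circleGap_nonneg q (P.point j)])
    rcases hshift c hc with ⟨j, rfl⟩ | hc'
    · rcases hshift d hd with ⟨l, rfl⟩ | hd'
      · rw [letter_point, letter_point] at h0; rw [h0]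
      · exact mixed j d (by rw [← h0, letter_point]) hd' h1
    · rcases hshift d hd with ⟨l, rfl⟩ | hd'
      · exact (mixed l c (by rw [h0, letter_point]) hc' h1.symm).symm
      · exact add_right_cancel (ih hc' hd' h1)

theorem exists_right_arc_sameCoding (P : CirclePartition p) (θ y : UnitAddCircle) (n : ℕ) :
    ∃ ε > 0, ∀ z, circleGap y z < ε → P.SameCoding θ n y z := by
  induction n with
  | zero => exact ⟨1, one_pos, fun z _ m hm => absurd hm (Nat.not_lt_zero m)⟩
  | succ n ih =>
    obtain ⟨ε, hε, h⟩ := ih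
    obtain ⟨δ, hδ, h'⟩ := P.exists_right_arc_letter_eq (y + n • θ)
    refine ⟨min ε δ, lt_min hε hδ, fun z hz m hm => ?_⟩
    rcases (Nat.lt_succ_iff_lt_or_eq.1 hm) with hm | rfl
    · exact h z (hz.trans_le (min_le_left _ _)) m hm
    · refine (h' _ ?_).symm
      rw [circleGap_add_right]
      exact hz.trans_le (min_le_right _ _)

/-- The step `φ` is separate from the coding angle `θ` so that both forward orbits (`φ = θ`) and
backward orbits (`φ = -θ`) are covered. -/
theorem exists_nsmul_sameCoding (P : CirclePartition p) {φ : UnitAddCircle}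
    (hφ : ∀ n : ℕ, n • φ = 0 → n = 0) (θ x y : UnitAddCircle) (n N : ℕ) :
    ∃ m, N ≤ m ∧ P.SameCoding θ n y (x + m • φ) ∧ x + m • φ ≠ y := by
  obtain ⟨ε, hε, h⟩ := P.exists_right_arc_sameCoding θ y n
  obtain ⟨m, hm, h0, h1⟩ := exists_nsmul_mem_right_arc hφ x y hε N
  refine ⟨m, hm, h _ h1, fun he => ?_⟩
  rw [he, circleGap_self] at h0
  exact h0.ne rfl

/-! ### First returns and return points -/

/-- `r` is the first positive time at which the orbit of `c` has the same coding of length `n`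
as `y`. -/
def IsFirstReturn (P : CirclePartition p) (θ : UnitAddCircle) (n : ℕ) (y c : UnitAddCircle)
    (r : ℕ) : Prop :=
  0 < r ∧ P.SameCoding θ n y (c + r • θ) ∧ ∀ m, 0 < m → m < r → ¬ P.SameCoding θ n y (c + m • θ)

theorem IsFirstReturn.le (h : P.IsFirstReturn θ n y c r) {m : ℕ} (hm : 0 < m)
    (h' : P.SameCoding θ n y (c + m • θ)) : r ≤ m :=
  not_lt.1 fun hlt => h.2.2 m hm hlt h'

theorem IsFirstReturn.unique {r' : ℕ} (h : P.IsFirstReturn θ n y c r)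
    (h' : P.IsFirstReturn θ n y c r') : r = r' :=
  le_antisymm (h.le h'.1 h'.2.1) (h'.le h.1 h.2.1)

theorem exists_isFirstReturn (P : CirclePartition p) (hθ : ∀ n : ℕ, n • θ = 0 → n = 0) (n : ℕ)
    (y c : UnitAddCircle) : ∃ r, P.IsFirstReturn θ n y c r := by
  classical
  have hex : ∃ m, 0 < m ∧ P.SameCoding θ n y (c + m • θ) := by
    obtain ⟨m, hm, h, -⟩ := P.exists_nsmul_sameCoding hθ θ c y n 1
    exact ⟨m, hm, h⟩
  exact ⟨Nat.find hex, (Nat.find_spec hex).1, (Nat.find_spec hex).2,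
    fun m h0 hm h => Nat.find_min hex hm ⟨h0, h⟩⟩

/-- The coding of length `r + n` records every window of length `n` starting at a time up to `r`,
hence decides which of them is the first return. -/
theorem IsFirstReturn.of_sameCoding (h : P.IsFirstReturn θ n y c r)
    (hc : P.SameCoding θ (r + n) c z) : P.IsFirstReturn θ n y z r := by
  refine ⟨h.1, h.2.1.trans (sameCoding_add_iff.1 hc).2, fun m h0 hm hs => h.2.2 m h0 hm ?_⟩
  exact hs.trans (sameCoding_add_iff.1 (hc.mono (Nat.add_le_add_right hm.le n))).2.symm

/-- The points `c` with the same coding of length `n` as `y` that are leftmost among the points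
with the same coding up to the end of the first return. -/
def returnPoints (P : CirclePartition p) (θ : UnitAddCircle) (n : ℕ) (y : UnitAddCircle) :
    Set UnitAddCircle :=
  {c | P.SameCoding θ n y c ∧ ∃ r, P.IsFirstReturn θ n y c r ∧ c ∈ P.breakpoints θ (r + n)}

/-! ### Counting return points for a generic rotation -/

/-- The rotation by `θ` maps the division point `s` to the division point `t`, and there is no
other relation between the orbits of the division points. -/
structure IsGenericRotation (P : CirclePartition p) (θ : UnitAddCircle) (s t : Fin p) :
    Prop where
  ne : t ≠ s
  map_eq : P.point s + θ = P.point t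
  indep : ∀ j l : Fin p, j ≠ s → l ≠ s → ∀ m m' : ℕ, P.point j - m • θ = P.point l - m' • θ →
    j = l ∧ m = m'

namespace IsGenericRotation

variable {s t : Fin p}

theorem nsmul_eq_zero (H : P.IsGenericRotation θ s t) (m : ℕ) (hm : m • θ = 0) : m = 0 :=
  (H.indep t t H.ne H.ne m 0 (by simp [hm])).2

theorem nsmul_neg_eq_zero (H : P.IsGenericRotation θ s t) (m : ℕ) (hm : m • (-θ) = 0) : m = 0 :=
  H.nsmul_eq_zero m (by simpa using hm)

/-- The breakpoints are the points of initial segments of the disjoint backward orbits of the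
division points other than `s`; the initial segment is longer for the index `t`. -/
theorem mem_breakpoints_iff (H : P.IsGenericRotation θ s t) (hn : 0 < n) :
    c ∈ P.breakpoints θ n ↔
      ∃ j, j ≠ s ∧ ∃ m, m < n + (if j = t then 1 else 0) ∧ c = P.point j - m • θ := by
  constructor
  · rintro ⟨j, m, hm, hc⟩
    by_cases hj : j = s
    · subst hj
      refine ⟨t, H.ne, m + 1, by simpa using hm, ?_⟩
      rw [← H.map_eq, ← hc, succ_nsmul]; abel
    · exact ⟨j, hj, m, by omega, by rw [← hc]; abel⟩
  · rintro ⟨j, hj, m, hm, rfl⟩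
    by_cases hmn : m < n
    · exact ⟨j, m, hmn, by abel⟩
    · have hjt : j = t := by
        by_contra hne
        rw [if_neg hne] at hm
        omega
      subst hjt
      rw [if_pos rfl] at hm
      obtain ⟨q, rfl⟩ : ∃ q, n = q + 1 := ⟨n - 1, by omega⟩
      obtain rfl : m = q + 1 := by omega
      refine ⟨s, q, by omega, ?_⟩
      rw [← H.map_eq, succ_nsmul]; abel

theorem exists_first_backward_visit (H : P.IsGenericRotation θ s t) (n : ℕ)
    (a : UnitAddCircle) (j : Fin p) :
    ∃ M : ℕ, (P.SameCoding θ n a (P.point j - M • θ) ∧ P.point j - M • θ ≠ a) ∧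
      ∀ m < M, P.SameCoding θ n a (P.point j - m • θ) → P.point j - m • θ = a := by
  classical
  have hex : ∃ M : ℕ, P.SameCoding θ n a (P.point j - M • θ) ∧ P.point j - M • θ ≠ a := by
    obtain ⟨m, -, h, h'⟩ := P.exists_nsmul_sameCoding H.nsmul_neg_eq_zero θ (P.point j) a n 0
    have e : P.point j + m • (-θ) = P.point j - m • θ := by rw [smul_neg, sub_eq_add_neg]
    rw [e] at h h'
    exact ⟨m, h, h'⟩
  refine ⟨Nat.find hex, Nat.find_spec hex, fun m hm h => ?_⟩
  by_contra hne
  exact Nat.find_min hex hm ⟨h, hne⟩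

theorem encard_returnPoints_of_pos (H : P.IsGenericRotation θ s t) (hn : 0 < n)
    (y : UnitAddCircle) : (P.returnPoints θ n y).encard = p := by
  classical
  obtain ⟨a, ha, hay⟩ := P.exists_breakpoint_sameCoding θ y hn
  have huniq : ∀ d ∈ P.breakpoints θ n, P.SameCoding θ n a d → d = a := fun d hd h =>
    (eq_of_sameCoding_of_mem_breakpoints H.map_eq ha hd h).symm
  choose M hM hmin using H.exists_first_backward_visit n a
  have key : P.returnPoints θ n y =
      insert a ((fun j => P.point j - M j • θ) '' {j | j ≠ s}) := by
    ext c
    constructor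
    · rintro ⟨hc, r, hr, hcr⟩
      by_cases hca : c = a
      · exact Or.inl hca
      refine Or.inr ?_
      obtain ⟨j, hj, m, hm, rfl⟩ := (H.mem_breakpoints_iff (Nat.add_pos_right r hn)).1 hcr
      refine ⟨j, hj, ?_⟩
      rcases lt_trichotomy (M j) m with h | h | h
      · exfalso
        have e : P.point j - m • θ + (m - M j) • θ = P.point j - M j • θ := by
          obtain ⟨q, rfl⟩ := Nat.exists_eq_add_of_lt h
          rw [show M j + q + 1 - M j = q + 1 by omega, add_assoc, add_nsmul]; abel
        -- The orbit of `c` reaches the visit at time `M j` after `m - M j` steps, so `r ≤ m - M j`.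
        -- The bound on `m` then makes that visit a breakpoint for length `n`, which must be `a`.
        have hle := hr.le (m := m - M j) (by omega) (by rw [e]; exact hay.symm.trans (hM j).1)
        refine (hM j).2 (huniq _ ?_ (hM j).1)
        exact (H.mem_breakpoints_iff hn).2 ⟨j, hj, M j, by omega, rfl⟩
      · simp only [h]
      · exact absurd (hmin j m h (hay.trans hc)) hca
    · rintro (rfl | ⟨j, hj, rfl⟩)
      · obtain ⟨r, hr⟩ := P.exists_isFirstReturn H.nsmul_eq_zero n y c
        exact ⟨hay.symm, r, hr, breakpoints_mono (Nat.le_add_left n r) ha⟩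
      · obtain ⟨r, hr⟩ := P.exists_isFirstReturn H.nsmul_eq_zero n y (P.point j - M j • θ)
        refine ⟨hay.symm.trans (hM j).1, r, hr, ?_⟩
        refine (H.mem_breakpoints_iff (Nat.add_pos_right r hn)).2 ⟨j, hj, M j, ?_, rfl⟩
        by_cases hrM : M j < r
        · omega
        have e : P.point j - M j • θ + r • θ = P.point j - (M j - r) • θ := by
          obtain ⟨q, hq⟩ := Nat.exists_eq_add_of_le (not_lt.1 hrM)
          rw [hq, Nat.add_sub_cancel_left, add_nsmul]; abel
        have hpos := hr.1
        have hs := hr.2.1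
        rw [e] at hs
        -- The return lands on an earlier point of the same backward orbit, which by minimality of
        -- `M j` is `a`. Disjointness of the orbits identifies `M j - r` with the index of `a`, and
        -- this bounds `M j`.
        have hja := hmin j (M j - r) (by omega) (hay.trans hs)
        obtain ⟨l, hl, m, hm, hlm⟩ := (H.mem_breakpoints_iff hn).1 ha
        obtain ⟨rfl, hmm⟩ := H.indep j l hj hl _ _ (hja.trans hlm)
        omega
  have hinj : Set.InjOn (fun j => P.point j - M j • θ) {j | j ≠ s} :=
    fun j hj l hl h => (H.indep j l hj hl _ _ h).1
  rw [key, Set.encard_insert_of_notMem, hinj.encard_image, ← Set.compl_singleton_eq,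
    Set.encard_eq_coe_toFinset_card]
  · have hp := P.two_le
    simp [Finset.card_compl]
    norm_cast
    omega
  · rintro ⟨j, -, hj⟩
    exact (hM j).2 hj

theorem encard_returnPoints (H : P.IsGenericRotation θ s t) (n : ℕ) (y : UnitAddCircle) :
    (P.returnPoints θ n y).encard = p := by
  rcases Nat.eq_zero_or_pos n with rfl | hn
  -- For the empty word every first return takes time `1`, and the breakpoints for length `1` are
  -- the division points.
  · have key : P.returnPoints θ 0 y = Set.range P.point := by
      have hs : ∀ c, P.SameCoding θ 0 y c := fun c m hm => absurd hm (Nat.not_lt_zero m)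
      have h1 : ∀ c, P.IsFirstReturn θ 0 y c 1 := fun c =>
        ⟨one_pos, hs _, fun m h0 hm => by omega⟩
      ext c
      constructor
      · rintro ⟨-, r, hr, j, m, hm, hc⟩
        obtain rfl := hr.unique (h1 c)
        obtain rfl : m = 0 := by omega
        exact ⟨j, by rw [← hc]; simp⟩
      · rintro ⟨j, rfl⟩
        exact ⟨hs _, 1, h1 _, j, 0, by omega, by simp⟩
    rw [key, ← Set.image_univ, P.point_injective.encard_image]
    simp
  · exact H.encard_returnPoints_of_pos hn y

end IsGenericRotation

/-! ### From return words to return points -/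

theorem coding_apply (P : CirclePartition p) (α : ℝ) (x : UnitAddCircle) (i m : ℕ) :
    P.coding α x (i + m) = P.letter (x + i • (α : UnitAddCircle) + m • (α : UnitAddCircle)) := by
  rw [coding, add_nsmul, add_assoc]

theorem ofFn_letter_eq_iff (P : CirclePartition p) (θ y z : UnitAddCircle) (n : ℕ) :
    List.ofFn (fun m : Fin n => P.letter (y + (m : ℕ) • θ)) =
      List.ofFn (fun m : Fin n => P.letter (z + (m : ℕ) • θ)) ↔ P.SameCoding θ n y z := by
  rw [List.ofFn_injective.eq_iff, funext_iff]
  exact ⟨fun h m hm => h ⟨m, hm⟩, fun h m => h m m.2⟩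

theorem wordSegment_coding (P : CirclePartition p) (α : ℝ) (x : UnitAddCircle) (i n : ℕ) :
    wordSegment (P.coding α x) i n = List.ofFn (fun m : Fin n =>
      P.letter (x + i • (α : UnitAddCircle) + (m : ℕ) • (α : UnitAddCircle))) := by
  simp only [wordSegment, coding_apply]

theorem occursAt_coding_iff {α : ℝ} {x : UnitAddCircle} {w : List (Fin p)} {i₀ : ℕ}
    (h : OccursAt (P.coding α x) w i₀) (i : ℕ) : OccursAt (P.coding α x) w i ↔
      P.SameCoding α w.length (x + i₀ • (α : UnitAddCircle)) (x + i • (α : UnitAddCircle)) := by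
  rw [← ofFn_letter_eq_iff, ← wordSegment_coding, ← wordSegment_coding]
  unfold OccursAt at *
  rw [h]
  exact eq_comm

theorem isRecurrentWord_coding (P : CirclePartition p) {α : ℝ}
    (hα : ∀ n : ℕ, n • (α : UnitAddCircle) = 0 → n = 0) (x : UnitAddCircle) :
    IsRecurrentWord (P.coding α x) := by
  rintro w ⟨i₀, h⟩
  refine Set.infinite_of_forall_exists_gt fun N => ?_
  obtain ⟨m, hm, hs, -⟩ := P.exists_nsmul_sameCoding hα α x (x + i₀ • (α : UnitAddCircle))
    w.length (N + 1)
  exact ⟨m, (occursAt_coding_iff h m).2 hs, hm⟩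

theorem mem_returnWords_coding_iff {α : ℝ} {x : UnitAddCircle} {w v : List (Fin p)} {i₀ : ℕ}
    (h : OccursAt (P.coding α x) w i₀) : v ∈ returnWords (P.coding α x) w ↔
      ∃ i r : ℕ, P.SameCoding α w.length (x + i₀ • (α : UnitAddCircle)) (x + i • (α : UnitAddCircle)) ∧
        P.IsFirstReturn α w.length (x + i₀ • (α : UnitAddCircle)) (x + i • (α : UnitAddCircle)) r ∧
        v = List.ofFn (fun m : Fin r =>
          P.letter (x + i • (α : UnitAddCircle) + (m : ℕ) • (α : UnitAddCircle))) := by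
  have e : ∀ i m : ℕ, x + (i + m) • (α : UnitAddCircle) =
      x + i • (α : UnitAddCircle) + m • (α : UnitAddCircle) := fun i m => by
    rw [add_nsmul, add_assoc]
  constructor
  · rintro ⟨i, j, hij, hi, hj, hm, rfl⟩
    obtain ⟨r, rfl⟩ := Nat.exists_eq_add_of_le hij.le
    rw [occursAt_coding_iff h] at hi hj
    refine ⟨i, r, hi, ⟨by omega, by rwa [← e], fun m h0 hmr hs => ?_⟩, ?_⟩
    · refine hm (i + m) (by omega) (by omega) ?_
      rwa [occursAt_coding_iff h, e]
    · rw [Nat.add_sub_cancel_left, wordSegment_coding]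
  · rintro ⟨i, r, hi, ⟨h0, hr, hm⟩, rfl⟩
    refine ⟨i, i + r, by omega, (occursAt_coding_iff h i).2 hi,
      (occursAt_coding_iff h _).2 (by rwa [e]), fun m him hmr hs => ?_, ?_⟩
    · obtain ⟨q, rfl⟩ := Nat.exists_eq_add_of_le him.le
      rw [occursAt_coding_iff h, e] at hs
      exact hm q (by omega) (by omega) hs
    · rw [Nat.add_sub_cancel_left, wordSegment_coding]

/-- Return words correspond to the leftmost points of the sets of points with a given coding up to
the end of the first return. -/
theorem IsGenericRotation.hasPropertyR_coding {α : ℝ} {s t : Fin p}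
    (H : P.IsGenericRotation α s t) (x : UnitAddCircle) : HasPropertyR p (P.coding α x) := by
  rintro w ⟨i₀, h⟩
  set n := w.length
  set y := x + i₀ • (α : UnitAddCircle)
  have hret := fun v => mem_returnWords_coding_iff (v := v) h
  choose r hr using P.exists_isFirstReturn H.nsmul_eq_zero n y
  have hrc : ∀ c ∈ P.returnPoints α n y, c ∈ P.breakpoints α (r c + n) := by
    rintro c ⟨-, q, hq, hc⟩
    rwa [(hr c).unique hq]
  let F : UnitAddCircle → List (Fin p) := fun c =>
    List.ofFn (fun m : Fin (r c) => P.letter (c + (m : ℕ) • (α : UnitAddCircle)))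
  have himage : returnWords (P.coding α x) w = F '' P.returnPoints α n y := by
    ext v
    rw [hret]
    constructor
    · rintro ⟨i, q, hs, hq, rfl⟩
      -- The occurrence is replaced by the breakpoint of its cylinder of length `q + n`, which need
      -- not lie on the orbit of `x`.
      obtain ⟨c, hc, hcs⟩ := P.exists_breakpoint_sameCoding (n := q + n) α
        (x + i • (α : UnitAddCircle)) (Nat.add_pos_left hq.1 n)
      have hcq := hq.of_sameCoding hcs.symm
      refine ⟨c, ⟨hs.trans (hcs.mono (Nat.le_add_left n q)).symm, q, hcq, hc⟩, ?_⟩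
      obtain rfl := (hr c).unique hcq
      exact (P.ofFn_letter_eq_iff _ _ _ _).2 (hcs.mono (Nat.le_add_right _ n))
    · rintro ⟨c, ⟨hc, -⟩, rfl⟩
      obtain ⟨i, -, hi, -⟩ := P.exists_nsmul_sameCoding H.nsmul_eq_zero α x c (r c + n) 0
      exact ⟨i, r c, hc.trans (hi.mono (Nat.le_add_left n _)), (hr c).of_sameCoding hi,
        (P.ofFn_letter_eq_iff _ _ _ _).2 (hi.mono (Nat.le_add_right _ n))⟩
  have hinj : Set.InjOn F (P.returnPoints α n y) := by
    intro c hc d hd hcd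
    have hlen : r c = r d := by simpa [F] using congrArg List.length hcd
    have hs : P.SameCoding α (r c) c d := by
      simp only [F] at hcd
      rw [← hlen] at hcd
      exact (P.ofFn_letter_eq_iff _ _ _ _).1 hcd
    -- Each return word is followed by `w`, so equal return words give equal codings of length `r c
    -- + n`.
    refine eq_of_sameCoding_of_mem_breakpoints H.map_eq (hrc c hc) (hlen ▸ hrc d hd)
      (sameCoding_add_iff.2 ⟨hs, (hr c).2.1.symm.trans ?_⟩)
    rw [hlen]
    exact (hr d).2.1
  rw [himage, hinj.encard_image, H.encard_returnPoints]

end CirclePartition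

/-! ### Rational independence of the lengths -/

namespace CirclePartition

variable {p : ℕ}

/-- The cyclic successor of an index. -/
def next (P : CirclePartition p) (i : Fin p) : Fin p :=
  if h : (i : ℕ) + 1 < p then ⟨i + 1, h⟩ else P.first

theorem coe_rightEnd (P : CirclePartition p) (i : Fin p) :
    (P.rightEnd i : UnitAddCircle) = P.point (P.next i) := by
  unfold rightEnd next
  split_ifs
  · rfl
  · exact AddCircle.coe_add_period 1 _

theorem point_add_length (P : CirclePartition p) (i : Fin p) :
    P.point i + (P.length i : UnitAddCircle) = P.point (P.next i) := by
  rw [← coe_rightEnd, point, ← AddCircle.coe_add, length, add_sub_cancel]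

theorem next_ne (P : CirclePartition p) (i : Fin p) : P.next i ≠ i := by
  have := P.two_le
  intro h
  have h' := congrArg Fin.val h
  unfold next at h'
  split_ifs at h'
  · simp at h'
  · simp only [first] at h'; omega

theorem sum_length_lt (P : CirclePartition p) (j : ℕ) (hj : j ≤ p) :
    ∑ u : Fin p, (if (u : ℕ) < j then P.length u else 0) =
      (if h : j < p then P.pt ⟨j, h⟩ else P.pt P.first + 1) - P.pt P.first := by
  set f : ℕ → ℝ := fun j => if h : j < p then P.pt ⟨j, h⟩ else P.pt P.first + 1 with hf
  have hp : 0 < p := lt_of_lt_of_le Nat.zero_lt_two P.two_le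
  have h0 : f 0 = P.pt P.first := by rw [hf]; simp only [hp, dif_pos]; rfl
  have hlen : ∀ u : Fin p, P.length u = f (u + 1) - f u := fun u => by
    simp only [hf, length, rightEnd, u.2, dif_pos]
  have hfil : (Finset.range p).filter (· < j) = Finset.range j := by
    ext u; simp only [Finset.mem_filter, Finset.mem_range]; omega
  simp only [hlen]
  rw [Fin.sum_univ_eq_sum_range (fun u => if u < j then f (u + 1) - f u else 0),
    ← Finset.sum_filter, hfil, Finset.sum_range_sub, h0]

theorem sum_length (P : CirclePartition p) : ∑ u, P.length u = 1 := by
  have h := P.sum_length_lt p le_rfl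
  simpa using h

theorem pt_sub_pt_first (P : CirclePartition p) (j : Fin p) :
    P.pt j - P.pt P.first = ∑ u : Fin p, if (u : ℕ) < j then P.length u else 0 := by
  rw [P.sum_length_lt j j.2.le, dif_pos j.2]

/-- If the lengths are rationally independent, the rotation by plus or minus one of them has no
relations between the orbits of the division points, apart from the obvious one. -/
theorem eq_of_point_sub_nsmul_eq (P : CirclePartition p) (hind : LinearIndependent ℚ P.length)
    {i s : Fin p} (hs : s = i ∨ s = P.next i) {e : ℤ} (he : e ≠ 0) {j l : Fin p} (hj : j ≠ s)
    (hl : l ≠ s) {m m' : ℕ}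
    (h : P.point j - m • ((e * P.length i : ℝ) : UnitAddCircle) =
      P.point l - m' • ((e * P.length i : ℝ) : UnitAddCircle)) :
    j = l ∧ m = m' := by
  obtain ⟨N, hN⟩ : ∃ N : ℤ, (N : ℝ) = P.pt j - m * (e * P.length i) -
      (P.pt l - m' * (e * P.length i)) := by
    have h' : ((P.pt j - m • (e * P.length i) - (P.pt l - m' • (e * P.length i)) : ℝ) :
        UnitAddCircle) = 0 := by
      simp only [AddCircle.coe_sub, AddCircle.coe_nsmul]
      exact sub_eq_zero.2 h
    obtain ⟨N, hN⟩ := (AddCircle.coe_eq_zero_iff 1).1 h'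
    exact ⟨N, by simpa using hN⟩
  -- Coefficients of the relation written in the lengths: `P.pt j - P.pt P.first` is the sum of the
  -- lengths before `j`, and `N` is `N` times the sum of all lengths.
  set c : Fin p → ℤ := fun u => (if (u : ℕ) < j then 1 else 0) - (if (u : ℕ) < l then 1 else 0) +
    (if u = i then e * (m' - m) else 0) - N with hc
  have hsum : ∑ u, (c u : ℝ) * P.length u = 0 := by
    have e1 : ∀ u, (c u : ℝ) * P.length u = (if (u : ℕ) < j then P.length u else 0) -
        (if (u : ℕ) < l then P.length u else 0) +
        (if u = i then e * (m' - m) * P.length i else 0) - N * P.length u := by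
      intro u
      by_cases hu : u = i
      · subst hu
        simp only [hc, if_true]; push_cast; split_ifs <;> ring
      · simp only [hc, hu, if_false]; push_cast; split_ifs <;> ring
    simp only [e1, Finset.sum_sub_distrib, Finset.sum_add_distrib, ← pt_sub_pt_first,
      ← Finset.mul_sum, sum_length, Finset.sum_ite_eq', Finset.mem_univ, if_true]
    linarith
  have hzero : ∀ u, c u = 0 := by
    intro u
    have := Fintype.linearIndependent_iff.1 hind (fun u => (c u : ℚ))
      (by simpa [Rat.smul_def] using hsum) u
    exact_mod_cast this
  have hp := P.two_le
  have hne : ∀ u : ℕ, u < p → u ≠ i →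
      ((if u < j then 1 else 0) - (if u < l then 1 else 0) : ℤ) = N := by
    intro u hu hui
    have := hzero ⟨u, hu⟩
    simp only [hc, Fin.ext_iff, hui, if_false] at this
    linarith
  have hi := hzero i
  simp only [hc, if_true] at hi
  have hnext : (P.next i : ℕ) = if (i : ℕ) + 1 < p then (i : ℕ) + 1 else 0 := by
    unfold next
    split_ifs <;> rfl
  have hj' : (j : ℕ) ≠ s := fun h => hj (Fin.ext h)
  have hl' : (l : ℕ) ≠ s := fun h => hl (Fin.ext h)
  have hs' : (s : ℕ) = i ∨ (s : ℕ) = P.next i := hs.imp (congrArg _) (congrArg _)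
  rw [hnext] at hs'
  have hjp := j.2
  have hlp := l.2
  have hip := i.2
  -- If `i` is not the last index, both indicators vanish at `p - 1`. If it is, then `s` is `p - 1`
  -- or `0`: both vanish at `p - 2` in the first case, and both equal `1` at `0` in the second.
  have hN0 : N = 0 := by
    by_cases hlast : (i : ℕ) + 1 < p
    · have := hne (p - 1) (by omega) (by omega)
      split_ifs at this <;> omega
    · have h1 := hne 0 (by omega) (by omega)
      have h2 := hne (p - 2) (by omega) (by omega)
      split_ifs at h1 h2 hs' <;> omega
  -- The indicators differ at every index from the smaller of `j`, `l` up to just before the larger,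
  -- so `i` is the only such index. Then `j` and `l` are `i` and its successor in some order, and
  -- one of them is `s`.
  have hjl : (j : ℕ) = l := by
    rcases lt_trichotomy (j : ℕ) l with hlt | heq | hlt
    · have h1 := hne j hjp
      have h2 := hne (l - 1) (by omega)
      split_ifs at h1 h2 hs' <;> omega
    · exact heq
    · have h1 := hne l hlp
      have h2 := hne (j - 1) (by omega)
      split_ifs at h1 h2 hs' <;> omega
  refine ⟨Fin.ext hjl, ?_⟩
  rw [hjl, hN0] at hi
  have h0 : e * ((m' : ℤ) - m) = 0 := by linarith
  have := (mul_eq_zero.1 h0).resolve_left he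
  omega

theorem exists_isGenericRotation (P : CirclePartition p) (hind : LinearIndependent ℚ P.length)
    {α : ℝ} (hα : ∃ i : Fin p, α = P.length i ∨ α = -P.length i) :
    ∃ s t, P.IsGenericRotation (α : UnitAddCircle) s t := by
  obtain ⟨i, rfl | rfl⟩ := hα
  · refine ⟨i, P.next i, P.next_ne i, P.point_add_length i, fun j l hj hl m m' h => ?_⟩
    exact P.eq_of_point_sub_nsmul_eq hind (Or.inl rfl) one_ne_zero hj hl (by simpa using h)
  · refine ⟨P.next i, i, (P.next_ne i).symm, ?_, fun j l hj hl m m' h => ?_⟩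
    · rw [← point_add_length, AddCircle.coe_neg, add_neg_cancel_right]
    · exact P.eq_of_point_sub_nsmul_eq hind (Or.inr rfl) (neg_ne_zero.2 one_ne_zero) hj hl
        (by simpa using h)

end CirclePartition

theorem mainTheorem4 (k : ℕ) (P : CirclePartition k)
    (hind : LinearIndependent ℚ P.length)
    (α : ℝ) (hα : ∃ i : Fin k, α = P.length i ∨ α = -P.length i)
    (x : UnitAddCircle) :
    IsRecurrentWord (P.coding α x) ∧ HasPropertyR k (P.coding α x) := by
  obtain ⟨s, t, H⟩ := P.exists_isGenericRotation hind hα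
  exact ⟨P.isRecurrentWord_coding H.nsmul_eq_zero x, H.hasPropertyR_coding x⟩
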